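/- Let $m>1$ be an integer and let $q(x,y)=ax^2+bxy+cy^2$ be an integral binary quadratic form of discriminant $b^2-4ac=m^2$. In the topograph of $q$, the regions are the primitive vectors $\pm v\in\mathbb Z^2$, labelled $q(v)$; the vertices are the superbases $\{v_1,v_2,v_3\}$ ($v_1+v_2+v_3=0$, with $v_1,v_2$ a basis of $\mathbb Z^2$) up to a common sign, where the regions $\pm v_1,\pm v_2,\pm v_3$ meet; the edges are the bases $\{\pm v,\pm w\}$ of $\mathbb Z^2$, each separating the regions $\pm v$ and $\pm w$, joining the vertices $\{v,w,-v-w\}$ and $\{v,-w,w-v\}$, and labelled, up to a sign depending on orientation, by $e=q(v+w)-q(v)-q(w)$. A lake is a region with label $0$; there are two lakes $L_1\ne L_2$. The labels of the regions sharing an edge with $L_1$ (respectively $L_2$) all lie in one residue class modulo $m$; let $r$ (respectively $s$) be its representative in $\{0,\dots,m-1\}$. The river is the set of edges separating a region with positive label from a region with negative label. Suppose that $\gcd(r,m)=1$ (then also $\gcd(s,m)=1$). Let $\mathcal E$ be the set of edges that have an endpoint on the river (that is, an endpoint of a river edge) but neither belong to the river nor border a lake. Then $\mathcal E$ is finite,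 every $e\in\mathcal E$ has $|e|>m$, and $$\sum_{e\in\mathcal E}\operatorname{arctanh}\frac{m}{|e|}=\frac12\log\bigl(r(m-r)\,s(m-s)\bigr),$$ where $e$ also denotes the label of the edge $e$. -/

import Mathlib

namespace Topograph

/-- The lattice of integer vectors in the plane. -/
abbrev Vec : Type := ℤ × ℤ

/-- `v, w` form a basis of the lattice. -/
def IsBasis (v w : Vec) : Prop :=
  LinearIndependent ℤ ![v, w] ∧ Submodule.span ℤ {v, w} = ⊤

/-- A (representative of a) superbase: three vectors with sum zero, two of which form a basis. -/
def IsSuperbase (v₁ v₂ v₃ : Vec) : Prop :=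
  v₁ + v₂ + v₃ = 0 ∧ IsBasis v₁ v₂

/-- Primitive lattice vectors. -/
abbrev PrimVec : Type := {v : Vec // IsCoprime v.1 v.2}

/-- Primitive vectors are identified up to sign. -/
instance signSetoid : Setoid PrimVec where
  r v w := v.1 = w.1 ∨ v.1 = -w.1
  iseqv :=
    { refl := fun _ => Or.inl rfl
      symm := by
        rintro v w (h | h)
        · exact Or.inl h.symm
        · exact Or.inr (by rw [h, neg_neg])
      trans := by
        rintro u v w (h | h) (h' | h')
        · exact Or.inl (h.trans h')
        · exact Or.inr (h.trans h')
        · exact Or.inr (by rw [h, h'])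
        · exact Or.inl (by rw [h, h', neg_neg]) }

/-- The regions of a topograph: primitive lattice vectors up to sign. -/
def Region : Type := Quotient signSetoid

/-- The region of a primitive vector. -/
def region (v : PrimVec) : Region := Quotient.mk signSetoid v

/-- The vertices of a topograph: superbases up to sign and order, recorded as the set of
the three regions that meet at the vertex. -/
def Vertex : Type :=
  {X : Set Region // ∃ v₁ v₂ v₃ : PrimVec,
    IsSuperbase v₁.1 v₂.1 v₃.1 ∧ X = {region v₁, region v₂, region v₃}}

/-- The edges of a topograph: bases up to signs and order, recorded as the unordered pair of
the two regions that the edge separates. -/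
def Edge : Type :=
  {E : Sym2 Region // ∃ v w : PrimVec, IsBasis v.1 w.1 ∧ E = s(region v, region w)}

/-- The region `R` is one of the two regions along the edge `E`. -/
def Edge.Borders (E : Edge) (R : Region) : Prop := R ∈ E.1

/-- The vertex `X` is an endpoint of the edge `E`: the basis is part of the superbase. -/
def Edge.IsIncident (E : Edge) (X : Vertex) : Prop := ∀ R, E.Borders R → R ∈ X.1

/-- Two regions are adjacent when they share an edge. -/
def Region.IsAdjacent (R S : Region) : Prop := ∃ E : Edge, E.1 = s(R, S)

/-- The label of the region of `± v` in the topograph of `q` is `q v`. -/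
def Region.label (q : QuadraticForm ℤ Vec) : Region → ℤ :=
  Quotient.lift (fun v : PrimVec => q v.1) (by
    rintro v w (h | h)
    · simp only [h]
    · simp only [h, QuadraticMap.map_neg])

/-- The absolute value of the label of the edge between the regions `± v` and `± w` in the
topograph of `q`. The label itself is `q (v + w) - q v - q w`, with a sign that depends on the
orientation of the edge. -/
def pairAbsLabel (q : QuadraticForm ℤ Vec) : Region → Region → ℤ :=
  Quotient.lift₂ (fun v w : PrimVec => |QuadraticMap.polar q v.1 w.1|) (by
    rintro v w v' w' (h | h) (h' | h') <;>
      simp only [h, h', QuadraticMap.polar_neg_left, QuadraticMap.polar_neg_right, abs_neg])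

theorem pairAbsLabel_comm (q : QuadraticForm ℤ Vec) (R S : Region) :
    pairAbsLabel q R S = pairAbsLabel q S R := by
  induction R using Quotient.inductionOn
  induction S using Quotient.inductionOn
  simp only [pairAbsLabel, Quotient.lift₂_mk, QuadraticMap.polar_comm]

/-- The absolute value `|e|` of the label of an edge in the topograph of `q`. -/
def Edge.absLabel (q : QuadraticForm ℤ Vec) (E : Edge) : ℤ :=
  Sym2.lift ⟨pairAbsLabel q, pairAbsLabel_comm q⟩ E.1

/-- At a vertex with region labels `r, s, t`, the edge between `s` and `t`, oriented away from
the vertex, has label `s + t - r`; `Edge.absLabel` is its absolute value. -/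
theorem absLabel_eq (q : QuadraticForm ℤ Vec) (E : Edge) (v₁ v₂ v₃ : PrimVec)
    (h : IsSuperbase v₁.1 v₂.1 v₃.1) (hE : E.1 = s(region v₂, region v₃)) :
    E.absLabel q =
      |(region v₂).label q + (region v₃).label q - (region v₁).label q| := by
  have h1 : v₁.1 = -(v₂.1 + v₃.1) := by
    rw [eq_neg_iff_add_eq_zero, ← add_assoc]; exact h.1
  have h2 : E.absLabel q = |QuadraticMap.polar q v₂.1 v₃.1| := by
    unfold Edge.absLabel; rw [hE]; rfl
  have h3 : ∀ v : PrimVec, (region v).label q = q v.1 := fun _ => rfl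
  rw [h2, h3, h3, h3, h1, QuadraticMap.map_neg, QuadraticMap.polar, ← abs_neg]
  congr 1
  ring

/-- The discriminant `- e f - f g - e g` read off at the vertex of a superbase, where
`e, f, g` are the labels of the three edges, oriented away from the vertex. -/
def vertexDiscr (q : QuadraticForm ℤ Vec) (v₁ v₂ v₃ : Vec) : ℤ :=
  let r := q v₁
  let s := q v₂
  let t := q v₃
  let e := r + t - s
  let f := r + s - t
  let g := s + t - r;
  -(e * f) - f * g - e * g

/-- The discriminant of the topograph of `q`, read off at the superbase
`(1, 0), (0, 1), (-1, -1)`. The choice does not matter, see `vertexDiscr_eq_discr`. -/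
def discr (q : QuadraticForm ℤ Vec) : ℤ := vertexDiscr q (1, 0) (0, 1) (-1, -1)

theorem apply_eq (q : QuadraticForm ℤ Vec) (x y : ℤ) :
    q (x, y) = q (1, 0) * x ^ 2 + QuadraticMap.polar q (1, 0) (0, 1) * (x * y)
      + q (0, 1) * y ^ 2 := by
  have h : ((x, y) : Vec) = x • ((1, 0) : Vec) + y • ((0, 1) : Vec) := by ext <;> simp
  rw [h, QuadraticMap.map_add q, QuadraticMap.map_smul, QuadraticMap.map_smul,
    QuadraticMap.polar_smul_left, QuadraticMap.polar_smul_right]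
  simp only [smul_eq_mul]
  ring

/-- The discriminant of the topograph of `a x² + b x y + c y²` is `b² - 4 a c`. -/
theorem discr_eq (q : QuadraticForm ℤ Vec) :
    discr q = QuadraticMap.polar q (1, 0) (0, 1) ^ 2 - 4 * q (1, 0) * q (0, 1) := by
  simp only [discr, vertexDiscr]
  rw [apply_eq q (-1) (-1)]
  ring

theorem isBasis_iff (v w : Vec) : IsBasis v w ↔ IsUnit (v.1 * w.2 - v.2 * w.1) := by
  obtain ⟨a, b⟩ := v
  obtain ⟨c, d⟩ := w
  constructor
  · rintro ⟨-, h⟩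
    have h1 : ((1, 0) : Vec) ∈ Submodule.span ℤ {((a, b) : Vec), (c, d)} := h ▸ trivial
    have h2 : ((0, 1) : Vec) ∈ Submodule.span ℤ {((a, b) : Vec), (c, d)} := h ▸ trivial
    rw [Submodule.mem_span_pair] at h1 h2
    obtain ⟨x, y, hxy⟩ := h1
    obtain ⟨z, t, hzt⟩ := h2
    simp only [Prod.smul_mk, smul_eq_mul, Prod.mk_add_mk, Prod.mk.injEq] at hxy hzt
    refine IsUnit.of_mul_eq_one (x * t - y * z) ?_
    have : (a * d - b * c) * (x * t - y * z) =
      (x * a + y * c) * (z * b + t * d) - (x * b + y * d) * (z * a + t * c) := by ring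
    simp only at this ⊢
    rw [this, hxy.1, hxy.2, hzt.1, hzt.2]
    norm_num
  · intro h
    have hu : (a * d - b * c) * (a * d - b * c) = 1 := Int.isUnit_mul_self h
    refine ⟨?_, ?_⟩
    · rw [LinearIndependent.pair_iff]
      intro x y hxy
      simp only [Prod.smul_mk, smul_eq_mul, Prod.mk_add_mk, Prod.mk_eq_zero] at hxy
      have hx : x * (a * d - b * c) = 0 := by linear_combination d * hxy.1 - c * hxy.2
      have hy : y * (a * d - b * c) = 0 := by linear_combination a * hxy.2 - b * hxy.1
      have h0 : a * d - b * c ≠ 0 := h.ne_zero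
      exact ⟨(mul_eq_zero.mp hx).resolve_right h0, (mul_eq_zero.mp hy).resolve_right h0⟩
    · rw [Submodule.eq_top_iff']
      rintro ⟨x, y⟩
      rw [Submodule.mem_span_pair]
      refine ⟨(a * d - b * c) * (d * x - c * y), (a * d - b * c) * (a * y - b * x), ?_⟩
      simp only [Prod.smul_mk, smul_eq_mul, Prod.mk_add_mk, Prod.mk.injEq]
      exact ⟨by linear_combination x * hu, by linear_combination y * hu⟩

theorem vertexDiscr_eq_discr (q : QuadraticForm ℤ Vec) (v₁ v₂ v₃ : Vec)
    (h : IsSuperbase v₁ v₂ v₃) : vertexDiscr q v₁ v₂ v₃ = discr q := by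
  have hu := Int.isUnit_mul_self ((isBasis_iff _ _).1 h.2)
  have h3 : v₃ = -(v₁ + v₂) := by
    rw [eq_neg_iff_add_eq_zero, add_comm]; exact h.1
  obtain ⟨a, b⟩ := v₁
  obtain ⟨c, d⟩ := v₂
  subst h3
  rw [discr_eq]
  simp only [vertexDiscr, Prod.mk_add_mk, Prod.neg_mk]
  rw [apply_eq q a b, apply_eq q c d, apply_eq q (-(a + c)) (-(b + d))]
  simp only at hu
  linear_combination
    (QuadraticMap.polar q (1, 0) (0, 1) ^ 2 - 4 * q (1, 0) * q (0, 1)) * hu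

/-- A lake is a region with label zero. -/
def Region.IsLakeRegion (q : QuadraticForm ℤ Vec) (R : Region) : Prop := R.label q = 0

/-- The integer `r` is congruent modulo `m` to a label of a region adjacent to `L`. -/
def IsAdjacentResidue (q : QuadraticForm ℤ Vec) (m : ℤ) (L : Region) (r : ℤ) : Prop :=
  ∃ R : Region, L.IsAdjacent R ∧ R.label q ≡ r [ZMOD m]

/-- The river consists of the edges that separate a positive label from a negative one. -/
def Edge.IsRiver (q : QuadraticForm ℤ Vec) (E : Edge) : Prop :=
  ∃ R S : Region, E.1 = s(R, S) ∧ 0 < R.label q ∧ S.label q < 0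

/-- A vertex lies on the river when it is an endpoint of a river edge. -/
def Vertex.OnRiver (q : QuadraticForm ℤ Vec) (X : Vertex) : Prop :=
  ∃ E : Edge, E.IsRiver q ∧ E.IsIncident X

/-- The edges adjacent to the river: those with an endpoint on the river which neither belong to
the river nor border a lake. -/
def riverAdjacentEdges (q : QuadraticForm ℤ Vec) : Set Edge :=
  {E | (∃ X : Vertex, X.OnRiver q ∧ E.IsIncident X) ∧ ¬ E.IsRiver q ∧
    ∀ R : Region, E.Borders R → ¬ R.IsLakeRegion q}

end Topograph

/-! Since the discriminant is a square, `q` splits over the integers: a basis containing the lake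
vector of `L₁` gives linear forms `α`, `β` with `q = α β`. They identify the lattice with all `(a,
b)`, `b ≡ r a` mod `m`, and bases with pairs of determinant `± m` (`exists_isNullCoordinates`).

An edge adjacent to the river on the positive side is a basis `v, w`, taken in the open first
quadrant, whose difference has negative label. So it is a pair `(a, b)`, `(c, d)` with `a < c`, `d <
b`, `c b - a d = m` (`hullPairs`, `exists_bijOn`). Its label is `c b + a d = m + 2 a d > m`, so
`artanh (m / |e|) = 1/2 log (c b / (a d)) = f (a, b) - f (c, d)`, where `f (a, b) = 1/2 (log b - log
a)`.

These pairs link consecutive points of one finite chain from `(1, r)` to `(s, 1)`, where `r s ≡ 1`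
mod `m` (`dvd_mul_sub_one`). The sum telescopes to `1/2 (log r + log s)` (`finsum_hullPairs_sub`).
The negative side is the positive side of `-q`, with residues `m - r` and `m - s`. -/

namespace Topograph

/-! ### The chain of hull points and its telescoping sum -/

/-- The pairs of successive points on the boundary of the convex hull of the nonzero points with
positive coordinates in the lattice of all `(a, b)` with `b ≡ r a` modulo `m`. -/
def hullPairs (m r : ℤ) : Set (Vec × Vec) :=
  {t | m ∣ t.1.2 - r * t.1.1 ∧ m ∣ t.2.2 - r * t.2.1 ∧ 0 < t.1.1 ∧ t.1.1 < t.2.1 ∧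
    0 < t.2.2 ∧ t.2.2 < t.1.2 ∧ t.2.1 * t.1.2 - t.1.1 * t.2.2 = m}

/-- The points with a successor on the boundary of the convex hull, where the successor may lie
on the horizontal axis. -/
def hullPoints (m r : ℤ) : Set Vec :=
  {v | m ∣ v.2 - r * v.1 ∧ 0 < v.1 ∧ 0 < v.2 ∧ ∃ a b : ℤ, m ∣ b - r * a ∧ v.1 < a ∧ 0 ≤ b ∧
    b < v.2 ∧ a * v.2 - v.1 * b = m}

theorem hullPairs_finite (m r : ℤ) : (hullPairs m r).Finite := by
  refine ((Set.finite_Icc ((0, 0) : Vec) (m, m)).prod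
    (Set.finite_Icc ((0, 0) : Vec) (m, m))).subset ?_
  rintro ⟨⟨a, b⟩, ⟨c, d⟩⟩ ⟨-, -, h1, h2, h3, h4, h5⟩
  simp only at h1 h2 h3 h4 h5
  have hc : c ≤ m := by nlinarith
  have hb : b ≤ m := by nlinarith
  refine ⟨⟨⟨?_, ?_⟩, ⟨?_, ?_⟩⟩, ⟨⟨?_, ?_⟩, ⟨?_, ?_⟩⟩⟩ <;> dsimp only <;> lia

theorem hullPairs_injOn_fst {m r : ℤ} (hm : 0 < m) : Set.InjOn Prod.fst (hullPairs m r) := by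
  rintro ⟨⟨a, b⟩, ⟨c, d⟩⟩ ⟨-, h0, h1, h2, h3, h4, h5⟩ ⟨⟨a', b'⟩, ⟨c', d'⟩⟩
    ⟨-, h0', h1', h2', h3', h4', h5'⟩ h
  simp only [Prod.mk.injEq] at *
  obtain ⟨rfl, rfl⟩ := h
  obtain ⟨x, hx⟩ := h0
  obtain ⟨y, hy⟩ := h0'
  -- Two successors of `(a, b)` have the same determinant with it, so they differ by an integer
  -- multiple of it; `0 < d, d' < b` makes the multiple zero.
  have h : d' - d = b * (c * y - c' * x) := by
    apply mul_left_cancel₀ hm.ne'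
    linear_combination (-d' + b * c * r - b * c * r) * h5 + d * h5' + b * c * hy - b * c' * hx
  have hk : c * y - c' * x = 0 := by
    by_contra hne
    rcases lt_or_gt_of_ne hne with hlt | hlt <;> nlinarith
  rw [hk, mul_zero, sub_eq_zero] at h
  subst h
  have : c * b = c' * b := by linarith
  exact ⟨⟨rfl, rfl⟩, mul_right_cancel₀ (by lia) this, rfl⟩

theorem hullPairs_injOn_snd {m r : ℤ} (hm : 0 < m) : Set.InjOn Prod.snd (hullPairs m r) := by
  rintro ⟨⟨a, b⟩, ⟨c, d⟩⟩ ⟨h0, -, h1, h2, h3, h4, h5⟩ ⟨⟨a', b'⟩, ⟨c', d'⟩⟩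
    ⟨h0', -, h1', h2', h3', h4', h5'⟩ h
  simp only [Prod.mk.injEq] at *
  obtain ⟨rfl, rfl⟩ := h
  obtain ⟨x, hx⟩ := h0
  obtain ⟨y, hy⟩ := h0'
  have h : a - a' = c * (a * y - a' * x) := by
    apply mul_left_cancel₀ hm.ne'
    linear_combination a' * h5 - a * h5' + c * a * hy - c * a' * hx
  have hk : a * y - a' * x = 0 := by
    by_contra hne
    rcases lt_or_gt_of_ne hne with hlt | hlt <;> nlinarith
  rw [hk, mul_zero, sub_eq_zero] at h
  subst h
  have : c * b = c * b' := by linarith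
  exact ⟨⟨rfl, mul_left_cancel₀ (by lia) this⟩, rfl, rfl⟩

/-- Here `k` is the ceiling of `c / a`. If `v` has neighbours `u` and `w` in the chain, then `u + w
= k v`, so this `k` recovers one neighbour from the other. -/
theorem exists_mul_sub_mem {a c : ℤ} (ha : 0 < a) (hac : a < c) :
    ∃ k : ℤ, 2 ≤ k ∧ 0 ≤ k * a - c ∧ k * a - c < a := by
  refine ⟨-(-c / a), ?_, ?_, ?_⟩ <;>
    have h1 := Int.emod_add_mul_ediv (-c) a <;>
    have h2 := Int.emod_nonneg (-c) ha.ne' <;>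
    have h3 := Int.emod_lt_of_pos (-c) ha
  · by_contra h
    nlinarith
  · linarith
  · linarith

theorem eq_of_dvd_sub_of_lt {m a b : ℤ} (h : m ∣ a - b) (ha : 0 ≤ a) (ham : a < m) (hb : 0 ≤ b)
    (hbm : b < m) : a = b := by
  have := Int.eq_zero_of_abs_lt_dvd h (by rw [abs_lt]; lia)
  lia

/-- The only point whose successor falls on the horizontal axis is `(s, 1)`, with successor `(m,
0)`. -/
theorem image_fst_hullPairs {m r s : ℤ} (hs0 : 0 < s) (hsm : s < m)
    (hrs : m ∣ r * s - 1) :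
    insert (s, 1) (Prod.fst '' hullPairs m r) = hullPoints m r ∧
      (s, 1) ∉ Prod.fst '' hullPairs m r := by
  constructor
  · ext ⟨a, b⟩
    constructor
    · rintro (h | ⟨⟨⟨a, b⟩, ⟨c, d⟩⟩, ⟨h0, h0', h1, h2, h3, h4, h5⟩, h⟩)
      · obtain ⟨rfl, rfl⟩ := Prod.mk.inj h
        exact ⟨by rw [← dvd_neg]; simpa using hrs, hs0, one_pos, m, 0, by simp, hsm, le_rfl,
          one_pos, by ring⟩
      · obtain ⟨rfl, rfl⟩ := Prod.mk.inj h
        exact ⟨h0, h1, h3.trans h4, c, d, h0', h2, h3.le, h4, h5⟩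
    · rintro ⟨h0, h1, h2, c, d, h3, h4, h5, h6, h7⟩
      simp only at *
      rcases h5.lt_or_eq with hd | rfl
      · exact Or.inr ⟨((a, b), (c, d)), ⟨h0, h3, h1, h4, hd, h6, h7⟩, rfl⟩
      -- Successor on the axis: `m ∣ c` and `c b = m` force `b = 1`, and then `r a ≡ 1` gives `a =
      -- s`.
      · have hrm : IsCoprime m r := by
          obtain ⟨k, hk⟩ := hrs
          exact ⟨-k, s, by linear_combination hk⟩
        have hc : m ∣ c := hrm.dvd_of_dvd_mul_left (by simpa using h3)
        have hcm : m ≤ c := Int.le_of_dvd (by lia) hc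
        have hb : b = 1 := by nlinarith
        subst hb
        have : a = s := by
          refine eq_of_dvd_sub_of_lt (m := m) (hrm.dvd_of_dvd_mul_left ?_) h1.le (by lia) hs0.le hsm
          have := dvd_add h0 hrs
          rw [← dvd_neg]
          convert this using 2
          ring
        exact Or.inl (by rw [this])
  · rintro ⟨⟨⟨a, b⟩, ⟨c, d⟩⟩, ⟨-, -, h1, h2, h3, h4, -⟩, h⟩
    obtain ⟨rfl, rfl⟩ := Prod.mk.inj h
    simp only at *
    lia

/-- Every point except `(1, r)` has a predecessor off the vertical axis; that of `(1, r)` is `(0,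
m)`. -/
theorem image_snd_hullPairs {m r : ℤ} (hr0 : 0 < r) (hrm : r < m) :
    insert (1, r) (Prod.snd '' hullPairs m r) = hullPoints m r ∧
      (1, r) ∉ Prod.snd '' hullPairs m r := by
  constructor
  · ext ⟨a, b⟩
    constructor
    · rintro (h | ⟨⟨⟨a, b⟩, ⟨c, d⟩⟩, ⟨h0, h0', h1, h2, h3, h4, h5⟩, h⟩)
      · obtain ⟨rfl, rfl⟩ := Prod.mk.inj h
        obtain ⟨k, hk, hk1, hk2⟩ := exists_mul_sub_mem hr0 hrm
        exact ⟨by simp, one_pos, hr0, k, k * b - m, ⟨-1, by ring⟩, by simp only; lia, hk1, hk2,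
          by ring⟩
      · obtain ⟨rfl, rfl⟩ := Prod.mk.inj h
        simp only at *
        obtain ⟨k, hk, hk1, hk2⟩ := exists_mul_sub_mem h3 h4
        refine ⟨h0', by simp only; lia, h3, k * c - a, k * d - b, ?_, by simp only; nlinarith, hk1,
          hk2, by linear_combination h5⟩
        rw [show k * d - b - r * (k * c - a) = k * (d - r * c) - (b - r * a) by ring]
        exact dvd_sub (h0'.mul_left k) h0
    · rintro ⟨h0, h1, h2, c, d, h3, h4, h5, h6, h7⟩
      simp only at *
      obtain ⟨k, hk, hk1, hk2⟩ := exists_mul_sub_mem h1 h4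
      have hdet : a * (k * b - d) - (k * a - c) * b = m := by linear_combination h7
      have hd : m ∣ (k * b - d) - r * (k * a - c) := by
        rw [show k * b - d - r * (k * a - c) = k * (b - r * a) - (d - r * c) by ring]
        exact dvd_sub (h0.mul_left k) h3
      have hb : b < k * b - d := by nlinarith
      rcases hk1.lt_or_eq with hpos | hz
      · exact Or.inr ⟨((k * a - c, k * b - d), (a, b)), ⟨hd, h0, hpos, hk2, h2, hb, hdet⟩, rfl⟩
      -- The predecessor is `(0, k b - d)`; its height is divisible by `m` and `a (k b - d) = m`, so
      -- `a = 1`.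
      · rw [← hz] at hd hdet
        have hle : m ≤ k * b - d := Int.le_of_dvd (by lia) (by simpa using hd)
        have ha : a = 1 := by nlinarith
        subst ha
        have : b = r :=
          eq_of_dvd_sub_of_lt (m := m) (by simpa using h0) h2.le (by lia) hr0.le hrm
        exact Or.inl (by rw [this])
  · rintro ⟨⟨⟨a, b⟩, ⟨c, d⟩⟩, ⟨-, -, h1, h2, h3, h4, -⟩, h⟩
    obtain ⟨rfl, rfl⟩ := Prod.mk.inj h
    simp only at *
    lia

/-- First and second members each exhaust `hullPoints` up to one endpoint, so no enumeration of the
chain is needed. -/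
theorem finsum_hullPairs_sub {A : Type*} [AddCommGroup A] {m r s : ℤ} (hr0 : 0 < r)
    (hrm : r < m) (hs0 : 0 < s) (hsm : s < m) (hrs : m ∣ r * s - 1) (f : Vec → A) :
    ∑ᶠ t ∈ hullPairs m r, (f t.1 - f t.2) = f (1, r) - f (s, 1) := by
  have hfin := hullPairs_finite m r
  obtain ⟨h1, h1'⟩ := image_fst_hullPairs hs0 hsm hrs
  obtain ⟨h2, h2'⟩ := image_snd_hullPairs hr0 hrm
  have key : ∑ᶠ v ∈ insert (s, 1) (Prod.fst '' hullPairs m r), f v =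
      ∑ᶠ v ∈ insert (1, r) (Prod.snd '' hullPairs m r), f v := by rw [h1, h2]
  rw [finsum_mem_insert f h1' (hfin.image _), finsum_mem_insert f h2' (hfin.image _),
    finsum_mem_image (hullPairs_injOn_fst (by lia)),
    finsum_mem_image (hullPairs_injOn_snd (by lia))] at key
  rw [finsum_mem_sub_distrib _ _ hfin, sub_eq_sub_iff_add_eq_add, add_comm, key]

/-! ### Bases, signs, and the two sides of the river -/

theorem region_eq_iff {v w : PrimVec} : region v = region w ↔ v.1 = w.1 ∨ v.1 = -w.1 :=
  Quotient.eq

theorem exists_region_eq (R : Region) : ∃ v, region v = R := Quotient.exists_rep R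

theorem label_region (q : QuadraticForm ℤ Vec) (v : PrimVec) : (region v).label q = q v.1 := rfl

theorem IsBasis.symm {v w : Vec} (h : IsBasis v w) : IsBasis w v := by
  rw [isBasis_iff] at h ⊢
  rw [← IsUnit.neg_iff]
  convert h using 1
  ring

theorem IsBasis.neg_left {v w : Vec} (h : IsBasis v w) : IsBasis (-v) w := by
  rw [isBasis_iff] at h ⊢
  rw [← IsUnit.neg_iff]
  convert h using 1
  simp only [Prod.fst_neg, Prod.snd_neg]
  ring

theorem IsBasis.neg_right {v w : Vec} (h : IsBasis v w) : IsBasis v (-w) :=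
  h.symm.neg_left.symm

theorem IsBasis.sub_right {v w : Vec} (h : IsBasis v w) : IsBasis v (w - v) := by
  rw [isBasis_iff] at h ⊢
  convert h using 1
  simp only [Prod.fst_sub, Prod.snd_sub]
  ring

theorem IsBasis.isCoprime_left {v w : Vec} (h : IsBasis v w) : IsCoprime v.1 v.2 := by
  have hu := Int.isUnit_mul_self ((isBasis_iff v w).1 h)
  exact ⟨(v.1 * w.2 - v.2 * w.1) * w.2, -((v.1 * w.2 - v.2 * w.1) * w.1), by
    linear_combination hu⟩

theorem IsBasis.isCoprime_right {v w : Vec} (h : IsBasis v w) : IsCoprime w.1 w.2 :=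
  h.symm.isCoprime_left

theorem absLabel_eq_abs_polar (q : QuadraticForm ℤ Vec) {E : Edge} {v w : PrimVec}
    (hE : E.1 = s(region v, region w)) : E.absLabel q = |QuadraticMap.polar q v.1 w.1| := by
  unfold Edge.absLabel
  rw [hE]
  rfl

theorem absLabel_neg (q : QuadraticForm ℤ Vec) (E : Edge) : E.absLabel (-q) = E.absLabel q := by
  obtain ⟨v, w, -, hE⟩ := E.2
  rw [absLabel_eq_abs_polar _ hE, absLabel_eq_abs_polar _ hE, ← abs_neg]
  congr 1
  simp only [QuadraticMap.polar, _root_.neg_apply]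
  ring

theorem label_neg (q : QuadraticForm ℤ Vec) (R : Region) : R.label (-q) = -R.label q := by
  obtain ⟨v, rfl⟩ := exists_region_eq R
  simp only [label_region, _root_.neg_apply]

theorem isRiver_neg (q : QuadraticForm ℤ Vec) (E : Edge) : E.IsRiver (-q) ↔ E.IsRiver q := by
  constructor <;>
  · rintro ⟨R, S, hE, h1, h2⟩
    refine ⟨S, R, by rw [hE, Sym2.eq_swap], ?_, ?_⟩ <;> simp only [label_neg] at * <;> lia

/-- The edges adjacent to the river on its positive side. -/
def positiveRiverAdjacentEdges (q : QuadraticForm ℤ Vec) : Set Edge :=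
  {E | (∃ X : Vertex, X.OnRiver q ∧ E.IsIncident X) ∧ ∀ R, E.Borders R → 0 < R.label q}

/-- An edge off the river and bordering no lake has two nonzero labels of equal sign; negating `q`
leaves the river unchanged. -/
theorem riverAdjacentEdges_eq_union (q : QuadraticForm ℤ Vec) :
    riverAdjacentEdges q =
      positiveRiverAdjacentEdges q ∪ positiveRiverAdjacentEdges (-q) := by
  ext E
  obtain ⟨v, w, -, hE⟩ := E.2
  have hriver : E.IsRiver q ↔ 0 < q v.1 ∧ q w.1 < 0 ∨ 0 < q w.1 ∧ q v.1 < 0 := by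
    simp only [Edge.IsRiver, hE]
    constructor
    · rintro ⟨R, S, h, h1, h2⟩
      rcases Sym2.eq_iff.1 h with ⟨rfl, rfl⟩ | ⟨rfl, rfl⟩
      · exact Or.inl ⟨h1, h2⟩
      · exact Or.inr ⟨h1, h2⟩
    · rintro (⟨h1, h2⟩ | ⟨h1, h2⟩)
      · exact ⟨_, _, rfl, h1, h2⟩
      · exact ⟨_, _, Sym2.eq_swap, h1, h2⟩
  simp only [riverAdjacentEdges, positiveRiverAdjacentEdges, Vertex.OnRiver, isRiver_neg,
    Region.IsLakeRegion, label_neg, Set.mem_union, Set.mem_ofPred_eq, hriver, Edge.Borders, hE,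
    Sym2.mem_iff, forall_eq_or_imp, forall_eq, label_region, ← and_or_left]
  refine and_congr_right fun _ => ?_
  lia

theorem disjoint_positiveRiverAdjacentEdges_neg (q : QuadraticForm ℤ Vec) :
    Disjoint (positiveRiverAdjacentEdges q) (positiveRiverAdjacentEdges (-q)) := by
  rw [Set.disjoint_left]
  rintro E ⟨-, h⟩ ⟨-, h'⟩
  obtain ⟨v, w, -, hE⟩ := E.2
  have hv : E.Borders (region v) := by
    rw [Edge.Borders, hE]
    exact Sym2.mem_mk_left _ _
  have h1 := h _ hv
  have h2 := h' _ hv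
  rw [label_neg] at h2
  lia

theorem eq_add_or_sub_of_sum_eq_zero {u₁ u₂ u₃ v w z : Vec} (h : u₁ + u₂ + u₃ = 0)
    (hv : v = u₁ ∨ v = -u₁) (hw : w = u₂ ∨ w = -u₂) (hz : z = u₃ ∨ z = -u₃) :
    (z = v + w ∨ z = -(v + w)) ∨ z = v - w ∨ z = -(v - w) := by
  obtain rfl : u₃ = -(u₁ + u₂) := by
    rw [eq_neg_iff_add_eq_zero, add_comm]
    exact h
  rcases hv with rfl | rfl <;> rcases hw with rfl | rfl <;> rcases hz with rfl | rfl
  · exact Or.inl (Or.inr rfl)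
  · exact Or.inl (Or.inl (by abel))
  · exact Or.inr (Or.inr (by abel))
  · exact Or.inr (Or.inl (by abel))
  · exact Or.inr (Or.inl (by abel))
  · exact Or.inr (Or.inr (by abel))
  · exact Or.inl (Or.inl (by abel))
  · exact Or.inl (Or.inr (by abel))

/-- Of three regions that meet at a vertex, each is given by the sum or the difference of the
other two. -/
theorem Vertex.eq_add_or_sub (X : Vertex) {v w z : PrimVec} (hv : region v ∈ X.1)
    (hw : region w ∈ X.1) (hz : region z ∈ X.1) (hvw : region v ≠ region w)
    (hvz : region v ≠ region z) (hwz : region w ≠ region z) :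
    (z.1 = v.1 + w.1 ∨ z.1 = -(v.1 + w.1)) ∨ z.1 = v.1 - w.1 ∨ z.1 = -(v.1 - w.1) := by
  obtain ⟨u₁, u₂, u₃, ⟨hsum, -⟩, hX⟩ := X.2
  rw [hX] at hv hw hz
  have e132 : u₁.1 + u₃.1 + u₂.1 = 0 := by rw [← hsum]; abel
  have e213 : u₂.1 + u₁.1 + u₃.1 = 0 := by rw [← hsum]; abel
  have e231 : u₂.1 + u₃.1 + u₁.1 = 0 := by rw [← hsum]; abel
  have e312 : u₃.1 + u₁.1 + u₂.1 = 0 := by rw [← hsum]; abel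
  have e321 : u₃.1 + u₂.1 + u₁.1 = 0 := by rw [← hsum]; abel
  rcases hv with hv | hv | hv <;> rcases hw with hw | hw | hw <;>
  first
  | exact absurd (Eq.trans hv (Eq.symm hw)) hvw
  | rcases hz with hz | hz | hz <;>
    first
    | exact absurd (Eq.trans hv (Eq.symm hz)) hvz
    | exact absurd (Eq.trans hw (Eq.symm hz)) hwz
    | exact eq_add_or_sub_of_sum_eq_zero (by assumption) (region_eq_iff.1 hv)
        (region_eq_iff.1 hw) (region_eq_iff.1 hz)

/-! ### Null coordinates: positive-side edges as hull pairs -/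

/-- Linear coordinates in which `q` is the product of the coordinates, and which identify the
lattice with the set of all `(a, b)` such that `b ≡ r a` modulo `m`. -/
structure IsNullCoordinates (q : QuadraticForm ℤ Vec) (m r : ℤ) (α β : Vec →ₗ[ℤ] ℤ) : Prop where
  apply_eq_mul : ∀ v, q v = α v * β v
  eq_of_eq : ∀ v w, α v = α w → β v = β w → v = w
  dvd_sub : ∀ v, m ∣ β v - r * α v
  exists_eq : ∀ a b, m ∣ b - r * a → ∃ v, α v = a ∧ β v = b
  isBasis_iff_abs : ∀ v w, IsBasis v w ↔ |α v * β w - α w * β v| = m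

namespace IsNullCoordinates

variable {q : QuadraticForm ℤ Vec} {m r : ℤ} {α β : Vec →ₗ[ℤ] ℤ}

theorem neg (h : IsNullCoordinates q m r α β) : IsNullCoordinates (-q) m (m - r) (-α) β where
  apply_eq_mul v := by simp [h.apply_eq_mul]
  eq_of_eq v w h1 h2 := h.eq_of_eq v w (by simpa using h1) h2
  dvd_sub v := by
    rw [LinearMap.neg_apply, show β v - (m - r) * -α v = β v - r * α v + m * α v by ring]
    exact dvd_add (h.dvd_sub v) (dvd_mul_right _ _)
  exists_eq a b hab := by
    obtain ⟨v, hv, hv'⟩ := h.exists_eq (-a) b (by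
      rw [show b - r * -a = b - (m - r) * a + m * a by ring]
      exact dvd_add hab (dvd_mul_right _ _))
    exact ⟨v, by simp [hv], hv'⟩
  isBasis_iff_abs v w := by
    rw [h.isBasis_iff_abs, LinearMap.neg_apply, LinearMap.neg_apply, ← abs_neg]
    ring_nf

theorem polar_eq (h : IsNullCoordinates q m r α β) (v w : Vec) :
    QuadraticMap.polar q v w = α v * β w + α w * β v := by
  simp only [QuadraticMap.polar, h.apply_eq_mul, map_add]
  ring

theorem exists_pos_rep (h : IsNullCoordinates q m r α β) (v : PrimVec) (hv : 0 < q v.1) :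
    ∃ v' : PrimVec, region v' = region v ∧ (v'.1 = v.1 ∨ v'.1 = -v.1) ∧
      0 < α v'.1 ∧ 0 < β v'.1 := by
  rw [h.apply_eq_mul, mul_pos_iff] at hv
  rcases hv with hv | hv
  · exact ⟨v, rfl, Or.inl rfl, hv⟩
  · exact ⟨⟨-v.1, v.2.neg_neg⟩, region_eq_iff.2 (Or.inr rfl), Or.inr rfl, by
      simpa only [map_neg, neg_pos] using hv⟩

theorem eq_of_region_eq {v w : PrimVec} (hv : 0 < α v.1) (hw : 0 < α w.1)
    (hvw : region v = region w) : v.1 = w.1 := by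
  rcases region_eq_iff.1 hvw with h | h
  · exact h
  · rw [h, map_neg] at hv
    lia

theorem exists_edge (h : IsNullCoordinates q m r α β) (hm : 0 < m) {t : Vec × Vec}
    (ht : t ∈ hullPairs m r) :
    ∃ E ∈ positiveRiverAdjacentEdges q, ∃ v w : PrimVec, E.1 = s(region v, region w) ∧
      (α v.1, β v.1) = t.1 ∧ (α w.1, β w.1) = t.2 := by
  obtain ⟨⟨a, b⟩, ⟨c, d⟩⟩ := t
  obtain ⟨h1, h2, h3, h4, h5, h6, h7⟩ := ht
  simp only at h1 h2 h3 h4 h5 h6 h7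
  obtain ⟨v, rfl, rfl⟩ := h.exists_eq a b h1
  obtain ⟨w, rfl, rfl⟩ := h.exists_eq c d h2
  have hb : IsBasis v w := by
    rw [h.isBasis_iff_abs, ← abs_neg, neg_sub, h7, abs_of_pos hm]
  let v' : PrimVec := ⟨v, hb.isCoprime_left⟩
  let w' : PrimVec := ⟨w, hb.isCoprime_right⟩
  let n : PrimVec := ⟨-w, hb.neg_right.isCoprime_right⟩
  let u : PrimVec := ⟨w - v, hb.sub_right.isCoprime_right⟩
  have hn : region w' = region n := region_eq_iff.2 (Or.inr (neg_neg w).symm)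
  -- Writing the superbase as `v, -w, w - v` puts the negative region `w - v` at an endpoint of the
  -- edge; `F`, between `v` and `w - v`, is the river edge there.
  let X : Vertex := ⟨{region v', region n, region u}, v', n, u,
    ⟨show v + -w + (w - v) = 0 by abel, hb.neg_right⟩, rfl⟩
  let F : Edge := ⟨s(region v', region u), v', u, hb.sub_right, rfl⟩
  have hqv : 0 < q v := by
    rw [h.apply_eq_mul]
    exact mul_pos h3 (h5.trans h6)
  refine ⟨⟨s(region v', region w'), v', w', hb, rfl⟩,
    ⟨⟨X, ⟨F, ⟨region v', region u, rfl, hqv, ?_⟩, ?_⟩, ?_⟩, ?_⟩,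
    v', w', rfl, rfl, rfl⟩
  · change q (w - v) < 0
    rw [h.apply_eq_mul, map_sub, map_sub]
    exact mul_neg_of_pos_of_neg (by lia) (by lia)
  · intro R hR
    rcases Sym2.mem_iff.1 hR with rfl | rfl
    · exact Or.inl rfl
    · exact Or.inr (Or.inr rfl)
  · intro R hR
    rcases Sym2.mem_iff.1 hR with rfl | rfl
    · exact Or.inl rfl
    · exact Or.inr (Or.inl hn)
  · intro R hR
    rcases Sym2.mem_iff.1 hR with rfl | rfl
    · exact hqv
    · change 0 < q w
      rw [h.apply_eq_mul]
      exact mul_pos (h3.trans h4) h5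

theorem exists_mem_hullPairs (h : IsNullCoordinates q m r α β) (hm : 0 < m) {E : Edge}
    (hE : E ∈ positiveRiverAdjacentEdges q) :
    ∃ v w : PrimVec, E.1 = s(region v, region w) ∧
      ((α v.1, β v.1), (α w.1, β w.1)) ∈ hullPairs m r := by
  obtain ⟨⟨X, ⟨F, ⟨R, S, hF, -, hS⟩, hFX⟩, hEX⟩, hpos⟩ := hE
  obtain ⟨v₀, w₀, hb₀, hE₀⟩ := E.2
  have hEv : E.Borders (region v₀) := by
    rw [Edge.Borders, hE₀]
    exact Sym2.mem_mk_left _ _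
  have hEw : E.Borders (region w₀) := by
    rw [Edge.Borders, hE₀]
    exact Sym2.mem_mk_right _ _
  obtain ⟨v, hv, hv', hv1, hv2⟩ := h.exists_pos_rep v₀ (hpos _ hEv)
  obtain ⟨w, hw, hw', hw1, hw2⟩ := h.exists_pos_rep w₀ (hpos _ hEw)
  have hb : IsBasis v.1 w.1 := by
    rcases hv' with hv' | hv' <;> rcases hw' with hw' | hw' <;> rw [hv', hw']
    exacts [hb₀, hb₀.neg_right, hb₀.neg_left, hb₀.neg_left.neg_right]
  rw [← hv, ← hw] at hE₀
  rw [← hv] at hEv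
  rw [← hw] at hEw
  rw [h.isBasis_iff_abs] at hb
  obtain ⟨z, rfl⟩ := exists_region_eq S
  have hzX : region z ∈ X.1 := hFX _ (by
    rw [Edge.Borders, hF]
    exact Sym2.mem_mk_right _ _)
  have hvw : region v ≠ region w := fun he => by
    rw [eq_of_region_eq hv1 hw1 he, sub_self, abs_zero] at hb
    exact hm.ne hb
  have hvz : region v ≠ region z := fun he => by
    have := hpos _ hEv
    rw [he] at this
    exact this.not_gt hS
  have hwz : region w ≠ region z := fun he => by
    have := hpos _ hEw
    rw [he] at this
    exact this.not_gt hS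
  -- The negative region at `X` must be the third one, `± (v + w)` or `± (v - w)`; the sum of two
  -- vectors in the open first quadrant has positive label, so it is the difference.
  have hneg : (α v.1 - α w.1) * (β v.1 - β w.1) < 0 := by
    rw [label_region] at hS
    rcases X.eq_add_or_sub (hEX _ hEv) (hEX _ hEw) hzX hvw hvz hwz with (hz | hz) | hz | hz <;>
      rw [hz] at hS <;> try rw [QuadraticMap.map_neg] at hS
    · rw [h.apply_eq_mul, map_add, map_add] at hS
      exact absurd (mul_pos (add_pos hv1 hw1) (add_pos hv2 hw2)) hS.not_gt
    · rw [h.apply_eq_mul, map_add, map_add] at hS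
      exact absurd (mul_pos (add_pos hv1 hw1) (add_pos hv2 hw2)) hS.not_gt
    · rwa [h.apply_eq_mul, map_sub, map_sub] at hS
    · rwa [h.apply_eq_mul, map_sub, map_sub] at hS
  rcases mul_neg_iff.1 hneg with ⟨hα, hβ⟩ | ⟨hα, hβ⟩
  · refine ⟨w, v, by rw [hE₀, Sym2.eq_swap], h.dvd_sub _, h.dvd_sub _, hw1, by simp only; lia,
      hv2, by simp only; lia, ?_⟩
    rwa [abs_of_pos] at hb
    nlinarith
  · refine ⟨v, w, hE₀, h.dvd_sub _, h.dvd_sub _, hv1, by simp only; lia, hw2, by simp only; lia, ?_⟩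
    rw [abs_of_neg, neg_sub] at hb
    · exact hb
    · nlinarith

theorem exists_bijOn (h : IsNullCoordinates q m r α β) (hm : 0 < m) :
    ∃ e : Vec × Vec → Edge, Set.BijOn e (hullPairs m r) (positiveRiverAdjacentEdges q) ∧
      ∀ t ∈ hullPairs m r, (e t).absLabel q = t.2.1 * t.1.2 + t.1.1 * t.2.2 := by
  have hb : IsBasis (1, 0) (0, 1) := by simp [isBasis_iff]
  -- Default values for `choose!` outside `hullPairs`.
  have : Nonempty PrimVec := ⟨⟨_, hb.isCoprime_left⟩⟩
  have : Nonempty Edge := ⟨⟨_, ⟨_, hb.isCoprime_left⟩, ⟨_, hb.isCoprime_right⟩, hb, rfl⟩⟩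
  choose! e he v w hvw hv hw using fun t (ht : t ∈ hullPairs m r) => h.exists_edge hm ht
  have hswap : ∀ v₁ w₁ v₂ w₂ : PrimVec,
      ((α v₁.1, β v₁.1), (α w₁.1, β w₁.1)) ∈ hullPairs m r →
      ((α v₂.1, β v₂.1), (α w₂.1, β w₂.1)) ∈ hullPairs m r →
      s(region v₁, region w₁) = s(region v₂, region w₂) → v₁.1 = v₂.1 ∧ w₁.1 = w₂.1 := by
    rintro v₁ w₁ v₂ w₂ ⟨-, -, h1, h2, -⟩ ⟨-, -, h1', h2', -⟩ hs
    simp only at h1 h2 h1' h2'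
    rcases Sym2.eq_iff.1 hs with ⟨hv, hw⟩ | ⟨hv, hw⟩
    · exact ⟨eq_of_region_eq h1 h1' hv, eq_of_region_eq (h1.trans h2) (h1'.trans h2') hw⟩
    -- A crossed matching would reverse the strict order of the first coordinates.
    · have hv' := eq_of_region_eq h1 (h1'.trans h2') hv
      have hw' := eq_of_region_eq (h1.trans h2) h1' hw
      rw [hv', hw'] at h2
      exact absurd h2 h2'.not_gt
  have hmem : ∀ t ∈ hullPairs m r,
      ((α (v t).1, β (v t).1), (α (w t).1, β (w t).1)) ∈ hullPairs m r := fun t ht => by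
    rwa [hv t ht, hw t ht]
  refine ⟨e, ⟨he, fun t ht t' ht' hee => ?_, fun E hE => ?_⟩, fun t ht => ?_⟩
  · obtain ⟨h1, h2⟩ := hswap _ _ _ _ (hmem t ht) (hmem t' ht')
      (by rw [← hvw t ht, ← hvw t' ht', hee])
    exact Prod.ext (by rw [← hv t ht, ← hv t' ht', h1]) (by rw [← hw t ht, ← hw t' ht', h2])
  · obtain ⟨v₁, w₁, hE₁, ht⟩ := h.exists_mem_hullPairs hm hE
    refine ⟨_, ht, Subtype.ext ?_⟩
    have h1 := hv _ ht
    have h2 := hw _ ht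
    simp only [Prod.mk.injEq] at h1 h2
    rw [hvw _ ht, hE₁, show v _ = v₁ from Subtype.ext (h.eq_of_eq _ _ h1.1 h1.2),
      show w _ = w₁ from Subtype.ext (h.eq_of_eq _ _ h2.1 h2.2)]
  · rw [absLabel_eq_abs_polar q (hvw t ht), h.polar_eq, ← hv t ht, ← hw t ht]
    obtain ⟨-, -, h1, h2, h3, h4, -⟩ := hmem t ht
    simp only at h1 h2 h3 h4 ⊢
    rw [abs_of_pos (by nlinarith)]
    ring

end IsNullCoordinates

/-! ### The sum over one side of the river -/

theorem artanh_sub_div_add {x y : ℝ} (hx : 0 < x) (hy : 0 < y) :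
    Real.artanh ((x - y) / (x + y)) = 1 / 2 * (Real.log x - Real.log y) := by
  have hxy : 0 < x + y := add_pos hx hy
  rw [Real.artanh_eq_half_log, ← Real.log_div hx.ne' hy.ne']
  · congr 2
    rw [one_add_div hxy.ne', one_sub_div hxy.ne', div_div_div_cancel_right₀ hxy.ne']
    rw [show x + y + (x - y) = 2 * x by ring, show x + y - (x - y) = 2 * y by ring,
      mul_div_mul_left _ _ two_ne_zero]
  · constructor
    · rw [le_div_iff₀ hxy]
      linarith
    · rw [div_le_iff₀ hxy]
      linarith

theorem IsNullCoordinates.finsum_positiveRiverAdjacentEdges {q : QuadraticForm ℤ Vec} {m r s : ℤ}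
    {α β : Vec →ₗ[ℤ] ℤ} (h : IsNullCoordinates q m r α β) (hr0 : 0 < r) (hrm : r < m)
    (hs0 : 0 < s) (hsm : s < m) (hrs : m ∣ r * s - 1) :
    (positiveRiverAdjacentEdges q).Finite ∧
    (∀ E ∈ positiveRiverAdjacentEdges q, m < E.absLabel q) ∧
    ∑ᶠ E ∈ positiveRiverAdjacentEdges q, Real.artanh ((m : ℝ) / (E.absLabel q : ℝ)) =
      1 / 2 * (Real.log r + Real.log s) := by
  obtain ⟨e, hbij, hlabel⟩ := h.exists_bijOn (hr0.trans hrm)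
  refine ⟨hbij.image_eq ▸ (hullPairs_finite m r).image e, fun E hE => ?_, ?_⟩
  · obtain ⟨t, ht, rfl⟩ := hbij.surjOn hE
    rw [hlabel t ht]
    obtain ⟨-, -, h1, h2, h3, h4, h5⟩ := ht
    have := mul_pos h1 h3
    lia
  · have key := finsum_hullPairs_sub hr0 hrm hs0 hsm hrs
      (fun v => 1 / 2 * (Real.log v.2 - Real.log v.1))
    rw [← finsum_mem_eq_of_bijOn e hbij (f := fun t : Vec × Vec =>
      1 / 2 * (Real.log t.1.2 - Real.log t.1.1) - 1 / 2 * (Real.log t.2.2 - Real.log t.2.1)), key]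
    · simp only [Int.cast_one, Real.log_one]
      ring
    · intro t ht
      rw [hlabel t ht]
      obtain ⟨-, -, h1, h2, h3, h4, h5⟩ := ht
      have h6 := h1.trans h2
      have h7 := h3.trans h4
      -- Now the argument of `artanh` is `(x - y) / (x + y)` with `x = c b` and `y = a d`.
      rw [← h5]
      push_cast
      rify at h1 h3 h6 h7
      rw [artanh_sub_div_add (mul_pos h6 h7) (mul_pos h1 h3), Real.log_mul h6.ne' h7.ne',
        Real.log_mul h1.ne' h3.ne']
      ring

/-! ### Construction of null coordinates from a lake -/

theorem Region.IsAdjacent.exists_isBasis {R S : Region} (h : R.IsAdjacent S) :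
    ∃ v w : PrimVec, IsBasis v.1 w.1 ∧ region v = R ∧ region w = S := by
  obtain ⟨E, hE⟩ := h
  obtain ⟨v, w, hb, hvw⟩ := E.2
  rcases Sym2.eq_iff.1 (hvw.symm.trans hE) with ⟨hv, hw⟩ | ⟨hv, hw⟩
  · exact ⟨v, w, hb, hv, hw⟩
  · exact ⟨w, v, hb.symm, hw, hv⟩

theorem IsBasis.polar_sq_sub (q : QuadraticForm ℤ Vec) {v w : Vec} (h : IsBasis v w) :
    QuadraticMap.polar q v w ^ 2 - 4 * q v * q w = discr q := by
  rw [← vertexDiscr_eq_discr q v w (-(v + w)) ⟨by abel, h⟩]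
  simp only [vertexDiscr, QuadraticMap.map_neg, QuadraticMap.map_add q v w]
  ring

/-- For `u = x v + y w` one gets `q u = m x y + r y² = y (m x + r y)`, so `α = y` and `β = m x + r
y`. -/
theorem exists_isNullCoordinates_of_isBasis {m r : ℤ} (hm : 0 < m) {q : QuadraticForm ℤ Vec}
    {v w : Vec} (hb : IsBasis v w) (hv : q v = 0) (hw : q w = r)
    (hvw : QuadraticMap.polar q v w = m) :
    ∃ α β : Vec →ₗ[ℤ] ℤ, IsNullCoordinates q m r α β ∧ α v = 0 ∧ β v = m := by
  have hu := (isBasis_iff v w).1 hb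
  set δ := v.1 * w.2 - v.2 * w.1 with hδ
  have hδδ : δ * δ = 1 := Int.isUnit_mul_self hu
  obtain ⟨x, hx⟩ : ∃ x : Vec →ₗ[ℤ] ℤ, ∀ u, x u = δ * (u.1 * w.2 - u.2 * w.1) :=
    ⟨δ • (w.2 • LinearMap.fst ℤ ℤ ℤ - w.1 • LinearMap.snd ℤ ℤ ℤ), fun u => by
      simp only [LinearMap.smul_apply, LinearMap.sub_apply, LinearMap.fst_apply,
        LinearMap.snd_apply, smul_eq_mul]
      ring⟩
  obtain ⟨y, hy⟩ : ∃ y : Vec →ₗ[ℤ] ℤ, ∀ u, y u = δ * (v.1 * u.2 - v.2 * u.1) :=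
    ⟨δ • (v.1 • LinearMap.snd ℤ ℤ ℤ - v.2 • LinearMap.fst ℤ ℤ ℤ), fun u => by simp⟩
  have hxy : ∀ u, u = x u • v + y u • w := fun u => by
    rw [hx, hy]
    ext
    · simp only [Prod.fst_add, Prod.smul_fst, smul_eq_mul]
      linear_combination (-u.1) * hδδ + u.1 * δ * hδ
    · simp only [Prod.snd_add, Prod.smul_snd, smul_eq_mul]
      linear_combination (-u.2) * hδδ + u.2 * δ * hδ
  have hxv : x v = 1 := by rw [hx, ← hδ, hδδ]
  have hyv : y v = 0 := by rw [hy]; ring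
  have hxw : x w = 0 := by rw [hx]; ring
  have hyw : y w = 1 := by rw [hy, ← hδ, hδδ]
  have hdet : ∀ u z, y u * x z - y z * x u = -δ * (u.1 * z.2 - u.2 * z.1) := fun u z => by
    rw [hx, hx, hy, hy]
    linear_combination (-(u.1 * z.2 - u.2 * z.1) * δ) * hδδ +
      (u.1 * z.2 - u.2 * z.1) * δ * δ * hδ
  refine ⟨y, m • x + r • y, ⟨fun u => ?_, fun u z h1 h2 => ?_, fun u => ?_, fun a b hab => ?_,
    fun u z => ?_⟩, hyv, by simp [hxv, hyv]⟩
  · conv_lhs => rw [hxy u]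
    rw [QuadraticMap.map_add q, QuadraticMap.map_smul, QuadraticMap.map_smul,
      QuadraticMap.polar_smul_left, QuadraticMap.polar_smul_right, hv, hw, hvw]
    simp only [LinearMap.add_apply, LinearMap.smul_apply, smul_eq_mul]
    ring
  · simp only [LinearMap.add_apply, LinearMap.smul_apply, smul_eq_mul, h1, add_left_inj] at h2
    rw [hxy u, hxy z, h1, mul_left_cancel₀ hm.ne' h2]
  · simp
  · obtain ⟨k, hk⟩ := hab
    refine ⟨k • v + a • w, by
      rw [map_add, map_smul, map_smul, hyv, hyw, smul_zero, zero_add, smul_eq_mul, mul_one], ?_⟩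
    simp only [LinearMap.add_apply, LinearMap.smul_apply, smul_eq_mul, map_add, map_smul, hxv, hxw,
      hyv, hyw]
    linear_combination -hk
  · have h1 : y u * (m • x + r • y) z - y z * (m • x + r • y) u =
        m * (-δ * (u.1 * z.2 - u.2 * z.1)) := by
      rw [← hdet]
      simp only [LinearMap.add_apply, LinearMap.smul_apply, smul_eq_mul]
      ring
    rw [h1, isBasis_iff, abs_mul, abs_of_pos hm, abs_mul, abs_neg, Int.isUnit_iff_abs_eq.1 hu,
      one_mul, Int.isUnit_iff_abs_eq]
    constructor
    · intro h
      rw [h, mul_one]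
    · intro h
      exact mul_left_cancel₀ hm.ne' (h.trans (mul_one m).symm)

theorem exists_isNullCoordinates {m r : ℤ} (hm : 0 < m) {q : QuadraticForm ℤ Vec}
    (hD : discr q = m ^ 2) {L : Region} (hL : L.IsLakeRegion q)
    (hr : IsAdjacentResidue q m L r) :
    ∃ α β : Vec →ₗ[ℤ] ℤ, IsNullCoordinates q m r α β ∧
      ∃ v : PrimVec, region v = L ∧ α v.1 = 0 ∧ β v.1 = m := by
  obtain ⟨R, hLR, hR⟩ := hr
  obtain ⟨v, w, hb, rfl, rfl⟩ := hLR.exists_isBasis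
  rw [label_region] at hR
  have hv : q v.1 = 0 := hL
  -- As `q v = 0`, the discriminant is the square of the polar value, which is thus `± m`; replacing
  -- `v` by `-v` fixes the sign.
  obtain ⟨v', hv', hb', hqv', hpol⟩ : ∃ v' : PrimVec, region v' = region v ∧ IsBasis v'.1 w.1 ∧
      q v'.1 = 0 ∧ QuadraticMap.polar q v'.1 w.1 = m := by
    have h := hb.polar_sq_sub q
    rw [hv, hD, mul_zero, zero_mul, sub_zero, sq_eq_sq_iff_eq_or_eq_neg] at h
    rcases h with h | h
    · exact ⟨v, rfl, hb, hv, h⟩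
    · exact ⟨⟨-v.1, v.2.neg_neg⟩, region_eq_iff.2 (Or.inr rfl), hb.neg_left,
        by rw [QuadraticMap.map_neg, hv], by rw [QuadraticMap.polar_neg_left, h, neg_neg]⟩
  obtain ⟨k, hk⟩ := hR.symm.dvd
  -- Subtracting `k v'` from `w` lowers its label by `k m`, making it exactly `r`.
  have hb'' : IsBasis v'.1 (w.1 - k • v'.1) := by
    rw [isBasis_iff] at hb' ⊢
    convert hb' using 1
    simp only [Prod.fst_sub, Prod.snd_sub, Prod.smul_fst, Prod.smul_snd, smul_eq_mul]
    ring
  obtain ⟨α, β, h, h1, h2⟩ := exists_isNullCoordinates_of_isBasis (r := r) hm hb'' hqv'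
    (by
      rw [sub_eq_add_neg, ← neg_smul, QuadraticMap.map_add q, QuadraticMap.map_smul,
        QuadraticMap.polar_smul_right, QuadraticMap.polar_comm, hpol, hqv', smul_eq_mul,
        smul_eq_mul]
      linear_combination hk)
    (by
      rw [sub_eq_add_neg, ← neg_smul, QuadraticMap.polar_add_right, QuadraticMap.polar_smul_right,
        QuadraticMap.polar_self, hpol, hqv', smul_zero, smul_zero, add_zero])
  exact ⟨α, β, h, v', hv', h1, h2⟩

/-- The residues at the two lakes are inverse to each other. -/
theorem IsNullCoordinates.dvd_mul_sub_one {q : QuadraticForm ℤ Vec} {m r s : ℤ}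
    {α β : Vec →ₗ[ℤ] ℤ} (h : IsNullCoordinates q m r α β) (hm : 0 < m) (hcop : IsCoprime r m)
    {v : PrimVec} (hα : α v.1 = 0) (hβ : β v.1 = m) {L : Region} (hL : L.IsLakeRegion q)
    (hvL : region v ≠ L) (hs : IsAdjacentResidue q m L s) : m ∣ r * s - 1 := by
  obtain ⟨R, hLR, hR⟩ := hs
  obtain ⟨u, w, hb, rfl, rfl⟩ := hLR.exists_isBasis
  rw [label_region, h.apply_eq_mul] at hR
  have hu : q u.1 = 0 := hL
  rw [h.apply_eq_mul, mul_eq_zero] at hu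
  rw [h.isBasis_iff_abs] at hb
  have hunit : ∀ x y : ℤ, |m * (x * y)| = m → IsUnit x := fun x y hxy => by
    rw [abs_mul, abs_of_pos hm] at hxy
    exact isUnit_of_mul_isUnit_left (y := y) (Int.isUnit_iff_abs_eq.2
      (mul_left_cancel₀ hm.ne' (hxy.trans (mul_one m).symm)))
  rcases hu with hu | hu
  -- On the line `α = 0` the only primitive vectors are `± v`, the other lake.
  · exfalso
    obtain ⟨k, hk⟩ := h.dvd_sub u.1
    rw [hu, mul_zero, sub_zero] at hk
    rw [hu, hk, ← abs_neg, show -(0 * β w.1 - α w.1 * (m * k)) = m * (k * α w.1) by ring] at hb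
    apply hvL
    rw [region_eq_iff]
    rcases Int.isUnit_iff.1 (hunit _ _ hb) with rfl | rfl
    · exact Or.inl (h.eq_of_eq _ _ (by rw [hα, hu]) (by rw [hβ, hk, mul_one]))
    · exact Or.inr (h.eq_of_eq _ _ (by rw [map_neg, hα, hu, neg_zero])
        (by rw [map_neg, hβ, hk, mul_neg, mul_one, neg_neg]))
  -- With `β u = 0`, coprimality gives `m ∣ α u`, and the basis condition makes `β w` a unit. Then
  -- `r s ≡ r α(w) β(w) ≡ β(w)² = 1`.
  · have hdvd := h.dvd_sub u.1
    rw [hu, zero_sub, dvd_neg] at hdvd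
    obtain ⟨k, hk⟩ := hcop.symm.dvd_of_dvd_mul_left hdvd
    rw [hu, hk, show m * k * β w.1 - α w.1 * 0 = m * (β w.1 * k) by ring] at hb
    have hsq := Int.isUnit_mul_self (hunit _ _ hb)
    obtain ⟨i, hi⟩ := h.dvd_sub w.1
    obtain ⟨j, hj⟩ := hR.dvd
    exact ⟨r * j - β w.1 * i, by linear_combination r * hj - β w.1 * hi + hsq⟩

end Topograph

/-! ### Adding the two sides -/

theorem mainTheorem10 (m : ℤ) (hm : 1 < m) (q : QuadraticForm ℤ Topograph.Vec)
    (hD : Topograph.discr q = m ^ 2)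
    (L₁ L₂ : Topograph.Region) (hL₁ : L₁.IsLakeRegion q) (hL₂ : L₂.IsLakeRegion q) (hL : L₁ ≠ L₂)
    (r s : ℤ) (hr₀ : 0 ≤ r) (hrm : r < m) (hs₀ : 0 ≤ s) (hsm : s < m)
    (hr : Topograph.IsAdjacentResidue q m L₁ r) (hs : Topograph.IsAdjacentResidue q m L₂ s)
    (hcop : IsCoprime r m) :
    (Topograph.riverAdjacentEdges q).Finite ∧
    (∀ E ∈ Topograph.riverAdjacentEdges q, m < E.absLabel q) ∧
    ∑ᶠ E ∈ Topograph.riverAdjacentEdges q, Real.artanh ((m : ℝ) / (E.absLabel q : ℝ)) =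
      1 / 2 * Real.log ((r : ℝ) * ((m : ℝ) - r) * s * ((m : ℝ) - s)) := by
  obtain ⟨α, β, h, v, rfl, hα, hβ⟩ :=
    Topograph.exists_isNullCoordinates (one_pos.trans hm) hD hL₁ hr
  have hrs := h.dvd_mul_sub_one (one_pos.trans hm) hcop hα hβ hL₂ hL hs
  -- If `r` or `s` were zero, `r s ≡ 1` would read `m ∣ -1`.
  have hndvd : ¬ m ∣ (-1 : ℤ) := fun hdvd => by
    have := Int.le_of_dvd one_pos ((dvd_neg).1 hdvd)
    lia
  have hr0 : 0 < r := hr₀.lt_of_ne fun h0 => hndvd (by simpa [← h0] using hrs)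
  have hs0 : 0 < s := hs₀.lt_of_ne fun h0 => hndvd (by simpa [← h0] using hrs)
  obtain ⟨hfin, hlt, hsum⟩ := h.finsum_positiveRiverAdjacentEdges hr0 hrm hs0 hsm hrs
  obtain ⟨hfin', hlt', hsum'⟩ :=
    h.neg.finsum_positiveRiverAdjacentEdges (s := m - s) (by lia) (by lia) (by lia) (by lia) (by
      rw [show (m - r) * (m - s) - 1 = m * (m - r - s) + (r * s - 1) by ring]
      exact dvd_add (dvd_mul_right _ _) hrs)
  simp only [Topograph.absLabel_neg] at hlt' hsum'
  rw [Topograph.riverAdjacentEdges_eq_union]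
  refine ⟨hfin.union hfin', fun E hE => hE.elim (hlt E) (hlt' E), ?_⟩
  rw [finsum_mem_union (Topograph.disjoint_positiveRiverAdjacentEdges_neg q) hfin hfin', hsum,
    hsum']
  push_cast
  rify at hr0 hs0 hrm hsm
  rw [Real.log_mul (by have := sub_pos.2 hrm; positivity) (sub_pos.2 hsm).ne',
    Real.log_mul (by have := sub_pos.2 hrm; positivity) hs0.ne',
    Real.log_mul hr0.ne' (sub_pos.2 hrm).ne']
  ring
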